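/- **Theorem.** Work over the alphabet $\{a,b\}$ with $a\prec b$, and let words be ordered lexicographically (a proper prefix is smaller). A non-empty word is a *Nyldon word* if it has no factorization $\gamma_1\cdots\gamma_m$ with $m\ge 2$ into shorter non-empty Nyldon words such that $\gamma_1\preceq\gamma_2\preceq\cdots\preceq\gamma_m$. The *Nyldon factorization* $\mathrm{NF}(w)$ of a word $w$ is its unique factorization into Nyldon words $\gamma_1\preceq\cdots\preceq\gamma_m$. For a word $w$, let $\overline w$ be the word obtained by exchanging $a$ and $b$, and $w'$ the word obtained by deleting the last letter. The Thue–Morse words are $TM_0=a$ and $TM_k=TM_{k-1}\cdot\overline{TM_{k-1}}$ for $k\ge 1$. For $k\ge 1$ write $\mathrm{NF}(TM_{2k-1})=x_1,\ldots,x_{c_k}$ (the factors $x_i$ depend on $k$). Then for every $k\ge 2$ (so that $2k$ and $2k+1$ run over all $n\ge 4$) $$\mathrm{NF}(TM_{2k})=x_1,\ldots,x_{c_k-1},\;x_{c_k}\cdot\overline{TM_{2k-2}'},\;b\cdot TM_{2k-2},$$ $$\mathrm{NF}(TM_{2k+1})=x_1,\ldots,x_{c_k-1},\;x_{c_k}\cdot\overline{TM_{2k-2}'},\;b\cdot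 TM_{2k-2}\cdot\overline{TM_{2k}}.$$ Moreover $c_k-1=c_{k-1}$ for every $k\ge 3$. The claim includes that each of the words $TM_{2k-1}$, $TM_{2k}$, $TM_{2k+1}$ has exactly one non-decreasing factorization into Nyldon words. -/

import Mathlib

namespace NyldonTM

/-- A word `w` is Nyldon if it is non-empty and has no factorization into at least two
non-empty, strictly shorter Nyldon words that is lexicographically non-decreasing. In particular
each word of length one is Nyldon. Here `≤` on lists is the lexicographic order induced by
the order of the alphabet (a proper prefix is smaller). -/
def IsNyldon {α : Type*} [LinearOrder α] (w : List α) : Prop :=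
  w ≠ [] ∧ ¬ ∃ l : List (List α), 2 ≤ l.length ∧ l.flatten = w ∧ l.IsChain (· ≤ ·) ∧
    ∀ g ∈ l, g ≠ [] ∧ ∃ _ : g.length < w.length, IsNyldon g
termination_by w.length

/-- The list `l` of words is a factorization of `w` into Nyldon words in lexicographically
non-decreasing order. -/
def IsNyldonFactorization {α : Type*} [LinearOrder α] (w : List α) (l : List (List α)) : Prop :=
  l.flatten = w ∧ l.IsChain (· ≤ ·) ∧ ∀ g ∈ l, IsNyldon g

/-- `NF w l` means `NF(w) = l`: the word `w` has exactly one non-decreasing factorization into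
Nyldon words, and it is `l`. -/
def NF {α : Type*} [LinearOrder α] (w : List α) (l : List (List α)) : Prop :=
  ∀ l' : List (List α), IsNyldonFactorization w l' ↔ l' = l

/-- The letter `a` of the binary alphabet `Bool`, ordered by `a < b`. -/
abbrev a : Bool := false

/-- The letter `b` of the binary alphabet `Bool`. -/
abbrev b : Bool := true

/-- The bit-wise flip of a binary word. -/
def flip (w : List Bool) : List Bool := w.map (fun c => !c)

/-- The finite Thue-Morse words. -/
def TM : ℕ → List Bool
  | 0 => [a]
  | k + 1 => TM k ++ flip (TM k)

end NyldonTM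

/-! Reading a word from right to left, and merging each new letter with the blocks after it while it
is larger, produces the unique Nyldon factorization (`isNyldon_iff_nf`, `NF_iff_nf`); uniqueness
rests on `nf_flatten`.

For Thue–Morse, let t = TM_{2k+2} and let p b be its flip. Then TM_{2k+4} = t·pb·pb·t = (t p b p)(b
t), and TM_{2k+5} only prolongs the last block b t. A `Tower` records the factors L of t p b p and a
few Nyldon words beginning with b t. `Tower.succ` passes to T = t p b p b t and P = p b t t p: each
word needed there is b·(t p b p) followed by known Nyldon words. The letter b absorbs L, and the
resulting b t p b p exceeds b t and all words beginning with b t t or b t p b t, since t starts with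
a and p with b. -/

namespace NyldonTM

/-! ### Nyldon factorization by right-to-left merging -/

section Algorithm

variable {α : Type*} [LinearOrder α]

/-- Put a word in front of a list of words, merging it with the first entries of the list
as long as it is larger than the next one. -/
def mergeFront (u : List α) : List (List α) → List (List α)
  | [] => [u]
  | v :: l => if v < u then mergeFront (u ++ v) l else u :: v :: l

/-- The Nyldon factorization of a word, computed by reading the word from right to left. -/
def nf : List α → List (List α)
  | [] => []
  | c :: w => mergeFront [c] (nf w)

theorem le_append_right (u v : List α) : u ≤ u ++ v := by
  by_contra h
  rw [not_le] at h
  induction u with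
  | nil => simp at h
  | cons c u ih => exact ih (by simpa [List.cons_lt_cons_iff] using h)

theorem lt_append_right (u : List α) {v : List α} (hv : v ≠ []) : u < u ++ v :=
  lt_of_le_of_ne (le_append_right u v) (by simpa using hv.symm)

theorem flatten_mergeFront (u : List α) (l : List (List α)) :
    (mergeFront u l).flatten = u ++ l.flatten := by
  induction l generalizing u with
  | nil => simp [mergeFront]
  | cons v l ih =>
    unfold mergeFront
    split_ifs <;> simp [ih]

theorem flatten_nf (w : List α) : (nf w).flatten = w := by
  induction w with
  | nil => rfl
  | cons c w ih => simp [nf, flatten_mergeFront, ih]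

theorem mergeFront_eq_cons {u : List α} {l : List (List α)} (h : ∀ v ∈ l.head?, u ≤ v) :
    mergeFront u l = u :: l := by
  cases l with
  | nil => rfl
  | cons v l => simp [mergeFront, not_lt.2 (h v (by simp))]

theorem isChain_mergeFront {l : List (List α)} (hl : l.IsChain (· ≤ ·)) (u : List α) :
    (mergeFront u l).IsChain (· ≤ ·) := by
  induction l generalizing u with
  | nil => simp [mergeFront]
  | cons v l ih =>
    unfold mergeFront
    split_ifs with h
    · exact ih hl.tail _
    · exact List.isChain_cons_cons.2 ⟨not_lt.1 h, hl⟩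

theorem isChain_nf (w : List α) : (nf w).IsChain (· ≤ ·) := by
  induction w with
  | nil => simp [nf]
  | cons c w ih => exact isChain_mergeFront ih _

theorem exists_le_mem_mergeFront (u : List α) (l : List (List α)) :
    ∃ y ∈ mergeFront u l, u ≤ y := by
  induction l generalizing u with
  | nil => exact ⟨u, by simp [mergeFront], le_rfl⟩
  | cons v l ih =>
    unfold mergeFront
    split_ifs
    · obtain ⟨y, hy, h⟩ := ih (u ++ v)
      exact ⟨y, hy, (le_append_right u v).trans h⟩
    · exact ⟨u, by simp, le_rfl⟩

theorem exists_mem_mergeFront_ge (u : List α) {l : List (List α)} {x : List α} (hx : x ∈ l) :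
    ∃ y ∈ mergeFront u l, x ≤ y := by
  induction l generalizing u with
  | nil => simp at hx
  | cons v l ih =>
    unfold mergeFront
    split_ifs with h
    · rcases List.mem_cons.1 hx with rfl | hx
      · obtain ⟨y, hy, h'⟩ := exists_le_mem_mergeFront (u ++ x) l
        exact ⟨y, hy, h.le.trans ((le_append_right u x).trans h')⟩
      · exact ih _ hx
    · exact ⟨x, List.mem_cons_of_mem _ hx, le_rfl⟩

/-- A block v is swallowed only by some u > v, and the merged block is at least u, so prepending
letters never lowers the maximal block. Hence the blocks of a suffix of a one-block word g are at
most g. -/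
theorem exists_mem_nf_append_ge (r : List α) {s x : List α} (hx : x ∈ nf s) :
    ∃ y ∈ nf (r ++ s), x ≤ y := by
  induction r with
  | nil => exact ⟨x, hx, le_rfl⟩
  | cons c r ih =>
    obtain ⟨y, hy, h⟩ := ih
    obtain ⟨z, hz, h'⟩ := exists_mem_mergeFront_ge [c] hy
    exact ⟨z, hz, h.trans h'⟩

theorem mergeFront_append (u : List α) (l m : List (List α))
    (h : ∀ y ∈ mergeFront u l, ∀ z ∈ m.head?, y ≤ z) :
    mergeFront u (l ++ m) = mergeFront u l ++ m := by
  induction l generalizing u with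
  | nil => exact mergeFront_eq_cons (h u (by simp [mergeFront]))
  | cons v l ih =>
    simp only [mergeFront, List.cons_append] at h ⊢
    split_ifs at h ⊢
    · exact ih _ h
    · rfl

/-- Words that form a single block of `nf` can be put in front of a larger block. -/
theorem nf_append {g w : List α} (hg : nf g = [g]) (hw : ∀ v ∈ (nf w).head?, g ≤ v) :
    nf (g ++ w) = g :: nf w := by
  -- Induct over the suffixes s of g; the complement r is kept in order to bound the blocks of s by
  -- g, so that none merges into `nf w`.
  suffices ∀ s r : List α, r ++ s = g → nf (s ++ w) = nf s ++ nf w by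
    rw [this g [] rfl, hg]; rfl
  intro s
  induction s with
  | nil => simp [nf]
  | cons c s ih =>
    intro r hr
    rw [List.cons_append, nf, ih (r ++ [c]) (by simp [hr]), nf]
    refine mergeFront_append _ _ _ fun y hy z hz => ?_
    obtain ⟨y', hy', h⟩ := exists_mem_nf_append_ge r (s := c :: s) hy
    rw [hr, hg, List.mem_singleton] at hy'
    exact h.trans (hy' ▸ hw z hz)

theorem nf_flatten {l : List (List α)} (hl : l.IsChain (· ≤ ·)) (h : ∀ g ∈ l, nf g = [g]) :
    nf l.flatten = l := by
  induction l with
  | nil => rfl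
  | cons g l ih =>
    have ih' := ih hl.tail fun x hx => h x (List.mem_cons_of_mem _ hx)
    rw [List.flatten_cons, nf_append (h g (by simp)), ih']
    rw [ih']
    exact (List.isChain_cons.1 hl).1

/-- Merging affects only an initial segment of the list. This makes every run of consecutive blocks
of `nf w` its own factorization. -/
theorem exists_of_mergeFront_eq_append {u x : List α} {l L M : List (List α)}
    (h : mergeFront u l = (x :: L) ++ M) : ∃ N, l = N ++ M ∧ mergeFront u N = x :: L := by
  induction l generalizing u with
  | nil =>
    simp only [mergeFront, List.cons_append, List.cons.injEq] at h
    obtain ⟨rfl, h⟩ := h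
    obtain ⟨rfl, rfl⟩ := List.append_eq_nil_iff.1 h.symm
    exact ⟨[], rfl, rfl⟩
  | cons v l ih =>
    unfold mergeFront at h
    split_ifs at h with hv
    · obtain ⟨N, rfl, hN⟩ := ih h
      exact ⟨v :: N, rfl, by simp [mergeFront, hv, hN]⟩
    · simp only [List.cons_append, List.cons.injEq] at h
      obtain ⟨rfl, h⟩ := h
      refine ⟨L, h, mergeFront_eq_cons fun z hz => ?_⟩
      cases L with
      | nil => simp at hz
      | cons v' L =>
        simp only [List.cons_append, List.cons.injEq] at h
        simp only [List.head?_cons, Option.mem_some_iff] at hz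
        rw [← hz, ← h.1]
        exact not_lt.1 hv

theorem nf_flatten_of_eq_append_left {w : List α} {L M : List (List α)} (h : nf w = L ++ M) :
    nf L.flatten = L := by
  induction w generalizing L with
  | nil =>
    obtain ⟨rfl, -⟩ := List.append_eq_nil_iff.1 h.symm
    rfl
  | cons c w ih =>
    cases L with
    | nil => rfl
    | cons x L =>
      obtain ⟨N, hN, hx⟩ := exists_of_mergeFront_eq_append h
      have := flatten_mergeFront [c] N
      rw [hx] at this
      rw [this, List.singleton_append, nf, ih hN, hx]

theorem nf_flatten_of_eq_append_right {w : List α} {L M : List (List α)} (h : nf w = L ++ M) :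
    nf M.flatten = M := by
  induction w generalizing L with
  | nil =>
    obtain ⟨-, rfl⟩ := List.append_eq_nil_iff.1 h.symm
    rfl
  | cons c w ih =>
    cases L with
    | nil => rw [List.nil_append] at h; rw [← h, flatten_nf]
    | cons x L =>
      obtain ⟨N, hN, -⟩ := exists_of_mergeFront_eq_append h
      exact ih hN

theorem nf_of_mem_nf {w x : List α} (h : x ∈ nf w) : nf x = [x] := by
  obtain ⟨L, M, hLM⟩ := List.append_of_mem h
  have h' : nf w = (L ++ [x]) ++ M := by simp [hLM]
  simpa using nf_flatten_of_eq_append_right (nf_flatten_of_eq_append_left h')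

theorem ne_nil_of_nf {w : List α} (h : nf w = [w]) : w ≠ [] := by
  rintro rfl
  simp [nf] at h

/-- If `nf w` has several blocks, these are shorter Nyldon words by induction and form a forbidden
factorization. Conversely, `nf_flatten` identifies any forbidden factorization with `nf w`, which
has one block. -/
theorem isNyldon_iff_nf (w : List α) : IsNyldon w ↔ nf w = [w] := by
  induction hn : w.length using Nat.strong_induction_on generalizing w with
  | _ n ih =>
    subst hn
    rw [IsNyldon]
    constructor
    · rintro ⟨hw, h⟩
      by_contra hne
      refine h ⟨nf w, ?_, flatten_nf w, isChain_nf w, fun g hg => ?_⟩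
      · rcases hN : nf w with _ | ⟨x, _ | ⟨y, l⟩⟩
        · have := flatten_nf w
          rw [hN] at this
          exact absurd this.symm hw
        · have := flatten_nf w
          rw [hN] at this
          simp only [List.flatten_cons, List.flatten_nil, List.append_nil] at this
          exact absurd (this ▸ hN) hne
        · simp
      · have hg' := nf_of_mem_nf hg
        have hlt : g.length < w.length := by
          have hsub : g.length ≤ w.length := by
            have := (List.sublist_flatten_of_mem hg).length_le
            rwa [flatten_nf] at this
          refine lt_of_le_of_ne hsub fun he => hne ?_
          have : g = w := by
            have := List.sublist_flatten_of_mem hg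
            rw [flatten_nf] at this
            exact this.eq_of_length he
          rwa [this] at hg'
        exact ⟨ne_nil_of_nf hg', hlt, (ih _ hlt g rfl).2 hg'⟩
    · intro h
      refine ⟨ne_nil_of_nf h, ?_⟩
      rintro ⟨l, hl, rfl, hc, hN⟩
      have := nf_flatten hc fun g hg => by
        obtain ⟨-, hlt, hg⟩ := hN g hg
        exact (ih _ hlt g rfl).1 hg
      rw [h] at this
      rw [← this] at hl
      simp at hl

theorem NF_iff_nf (w : List α) (l : List (List α)) : NF w l ↔ nf w = l := by
  have key : ∀ l', IsNyldonFactorization w l' ↔ l' = nf w := by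
    intro l'
    constructor
    · rintro ⟨rfl, hc, hN⟩
      exact (nf_flatten hc fun g hg => (isNyldon_iff_nf g).1 (hN g hg)).symm
    · rintro rfl
      exact ⟨flatten_nf w, isChain_nf w, fun g hg => (isNyldon_iff_nf g).2 (nf_of_mem_nf hg)⟩
  refine ⟨fun h => ?_, ?_⟩
  · exact (h _).1 ((key _).2 rfl)
  · rintro rfl
    exact key

/-- Placed in front of the list `l`, the word `u` merges with all of its entries. -/
def Absorbs (u : List α) : List (List α) → Prop
  | [] => True
  | v :: l => v < u ∧ Absorbs (u ++ v) l

theorem Absorbs.append {u : List α} {l m : List (List α)} (hl : Absorbs u l)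
    (hm : Absorbs (u ++ l.flatten) m) : Absorbs u (l ++ m) := by
  induction l generalizing u with
  | nil => simpa using hm
  | cons v l ih => exact ⟨hl.1, ih hl.2 (by simpa using hm)⟩

theorem Absorbs.mergeFront_eq {u : List α} {l : List (List α)} (h : Absorbs u l) :
    mergeFront u l = [u ++ l.flatten] := by
  induction l generalizing u with
  | nil => simp [mergeFront]
  | cons v l ih => simp [mergeFront, h.1, ih h.2]

/-- A letter followed by a factorization all of which it absorbs is a Nyldon word. -/
theorem nf_cons_of_absorbs {c : α} {w : List α} (l : List (List α)) (hw : l.flatten = w)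
    (hl : l.IsChain (· ≤ ·)) (h : ∀ g ∈ l, nf g = [g]) (hc : Absorbs [c] l) :
    nf (c :: w) = [c :: w] := by
  subst hw
  rw [nf, nf_flatten hl h, hc.mergeFront_eq]
  rfl

end Algorithm

/-! ### Nyldon words built from Thue–Morse blocks -/

section ThueMorse

theorem append_lt_append_iff_left {α : Type*} [LinearOrder α] (u : List α) {v w : List α} :
    u ++ v < u ++ w ↔ v < w := by
  induction u with
  | nil => rfl
  | cons c u ih => simpa [List.cons_lt_cons_iff] using ih

/-- Nyldon words built from words `t` and `p`, where `t` plays the role of `TM (2 * k)`, `p` that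
of `flip (TM (2 * k))` without its last letter, and `L` lists the stable factors. -/
structure Tower (t p : List Bool) (L : List (List Bool)) : Prop where
  t_eq : ∃ t', t = a :: t'
  p_eq : ∃ p', p = b :: p'
  flatten_eq : L.flatten = t ++ p ++ b :: p
  isChain : L.IsChain (· ≤ ·)
  nf_mem : ∀ g ∈ L, nf g = [g]
  absorbs : Absorbs [b] L
  le_of_mem : ∀ g ∈ L, ∀ w, g ≤ b :: t ++ w
  nf_bt : nf (b :: t) = [b :: t]
  nf_bttp : ∀ v ∈ [[], [b], b :: (p ++ b :: t ++ t ++ p)],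
    nf (b :: t ++ t ++ p ++ v) = [b :: t ++ t ++ p ++ v]
  nf_btp : ∀ v ∈ [[], [b], b :: (p ++ b :: t ++ t ++ p)],
    nf (b :: t ++ (p ++ b :: t ++ t ++ p) ++ v) = [b :: t ++ (p ++ b :: t ++ t ++ p) ++ v]
  nf_bttpbp : nf (b :: t ++ t ++ p ++ b :: p) = [b :: t ++ t ++ p ++ b :: p]

theorem tower_one : Tower [a, b, b, a] [b, a, a] [[a], [b], [b, a], [b, a, a, b, b, a, a]] where
  t_eq := ⟨_, rfl⟩
  p_eq := ⟨_, rfl⟩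
  flatten_eq := rfl
  isChain := by decide
  nf_mem := by decide
  absorbs := ⟨by decide, by decide, by decide, by decide, trivial⟩
  le_of_mem := by
    intro g hg w
    simp only [List.mem_cons, List.not_mem_nil, or_false] at hg
    rcases hg with rfl | rfl | rfl | rfl <;> refine le_of_lt ?_ <;> simp [List.cons_lt_cons_iff]
  nf_bt := by decide
  nf_bttp := by decide
  nf_btp := by decide
  nf_bttpbp := by decide

theorem isChain_append_of_le {α : Type*} [LinearOrder α] {L M : List α} {x : α}
    (hL : L.IsChain (· ≤ ·)) (hx : ∀ g ∈ L, g ≤ x) (hM : (x :: M).IsChain (· ≤ ·)) :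
    (L ++ x :: M).IsChain (· ≤ ·) := by
  refine List.isChain_append.2 ⟨hL, hM, fun g hg y hy => ?_⟩
  simp only [List.head?_cons, Option.mem_some_iff] at hy
  exact hy ▸ hx g (List.mem_of_mem_getLast? hg)

/-- The common pattern of the induction: after absorbing L, the leading b has become b t p b p, so
only the remaining blocks need checking. -/
theorem Tower.nf_cons {t p : List Bool} {L : List (List Bool)} (h : Tower t p L)
    {w v : List Bool} {M : List (List Bool)} (hw : w = L.flatten ++ (b :: t ++ v) ++ M.flatten)
    (hM : ((b :: t ++ v) :: M).IsChain (· ≤ ·))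
    (hN : ∀ g ∈ (b :: t ++ v) :: M, nf g = [g])
    (ha : Absorbs (b :: t ++ p ++ b :: p) ((b :: t ++ v) :: M)) :
    nf (b :: w) = [b :: w] := by
  refine nf_cons_of_absorbs (L ++ (b :: t ++ v) :: M) (by simp [hw])
    (isChain_append_of_le h.isChain (fun g hg => h.le_of_mem g hg v) hM) ?_ (h.absorbs.append ?_)
  · intro g hg
    rcases List.mem_append.1 hg with hg | hg
    · exact h.nf_mem g hg
    · exact hN g hg
  · simpa [h.flatten_eq] using ha

/-- With T and P the new words, the new stable factor is b t P b P. Among the endings v of b t P v,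
the empty one gives an inner block, b gives the last factor of TM_{2k+5}, and b P gives the stable
factor. -/
theorem Tower.succ {t p : List Bool} {L : List (List Bool)} (h : Tower t p L) :
    Tower (t ++ p ++ b :: p ++ b :: t) (p ++ b :: t ++ t ++ p)
      (L ++ [b :: t ++ (p ++ b :: t ++ t ++ p) ++ b :: (p ++ b :: t ++ t ++ p)]) := by
  have hle : ∀ w, b :: t ++ (p ++ b :: t ++ t ++ p) ++ b :: (p ++ b :: t ++ t ++ p) ≤
      b :: (t ++ p ++ b :: p ++ b :: t) ++ w := by
    obtain ⟨t', rfl⟩ := h.t_eq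
    obtain ⟨p', rfl⟩ := h.p_eq
    intro w
    refine le_of_lt ?_
    simp [List.cons_lt_cons_iff, append_lt_append_iff_left]
  have hD : ∀ v ∈ [[], [b]], nf (b :: (t ++ p ++ b :: p ++ b :: t) ++
      (t ++ p ++ b :: p ++ b :: t) ++ (p ++ b :: t ++ t ++ p) ++ v) =
      [b :: (t ++ p ++ b :: p ++ b :: t) ++
      (t ++ p ++ b :: p ++ b :: t) ++ (p ++ b :: t ++ t ++ p) ++ v] := by
    intro v hv
    -- Cut b T T P v as b · (t p b p) · (b t t p b p) · (b t P v).
    refine h.nf_cons (v := t ++ p ++ b :: p) (M := [b :: t ++ (p ++ b :: t ++ t ++ p) ++ v]) ?_ ?_ ?_ ?_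
    · simp [h.flatten_eq]
    · obtain ⟨t', rfl⟩ := h.t_eq
      obtain ⟨p', rfl⟩ := h.p_eq
      refine List.isChain_pair.2 (le_of_lt ?_)
      simp [List.cons_lt_cons_iff, append_lt_append_iff_left]
    · have h1 := h.nf_bttpbp
      have h2 := h.nf_btp v (by simp only [List.mem_cons] at hv ⊢; tauto)
      simp only [List.mem_cons, List.not_mem_nil, or_false]
      rintro g (rfl | rfl)
      · simpa using h1
      · exact h2
    · obtain ⟨t', rfl⟩ := h.t_eq
      obtain ⟨p', rfl⟩ := h.p_eq
      simp [Absorbs, List.cons_lt_cons_iff, append_lt_append_iff_left]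
  have hD' : ∀ v ∈ [[], [b], b :: ((p ++ b :: t ++ t ++ p) ++ b :: (t ++ p ++ b :: p ++ b :: t) ++
      (t ++ p ++ b :: p ++ b :: t) ++ (p ++ b :: t ++ t ++ p))],
      nf (b :: (t ++ p ++ b :: p ++ b :: t) ++
      (t ++ p ++ b :: p ++ b :: t) ++ (p ++ b :: t ++ t ++ p) ++ v) =
      [b :: (t ++ p ++ b :: p ++ b :: t) ++
      (t ++ p ++ b :: p ++ b :: t) ++ (p ++ b :: t ++ t ++ p) ++ v] := by
    intro v hv
    simp only [List.mem_cons, List.not_mem_nil, or_false] at hv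
    rcases hv with rfl | rfl | rfl
    · exact hD _ (by simp)
    · exact hD _ (by simp)
    -- The long ending adds the block b T T P, already handled by `hD`. The word accumulated before
    -- it is b T T P b P, which is larger as a proper extension.
    refine h.nf_cons (v := t ++ p ++ b :: p)
      (M := [b :: t ++ (p ++ b :: t ++ t ++ p) ++ b :: (p ++ b :: t ++ t ++ p),
        b :: (t ++ p ++ b :: p ++ b :: t) ++ (t ++ p ++ b :: p ++ b :: t) ++
          (p ++ b :: t ++ t ++ p)]) ?_ ?_ ?_ ?_
    · simp [h.flatten_eq]
    · refine List.isChain_cons_cons.2 ⟨le_of_lt ?_, List.isChain_pair.2 ?_⟩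
      · obtain ⟨t', rfl⟩ := h.t_eq
        obtain ⟨p', rfl⟩ := h.p_eq
        simp [List.cons_lt_cons_iff, append_lt_append_iff_left]
      · rw [List.append_assoc (b :: (t ++ p ++ b :: p ++ b :: t))]
        exact hle _
    · have h1 := h.nf_bttpbp
      have h2 := h.nf_btp _ (List.mem_cons_of_mem _ (List.mem_cons_of_mem _ List.mem_cons_self))
      have h3 := hD [] (by simp)
      simp only [List.mem_cons, List.not_mem_nil, or_false]
      rintro g (rfl | rfl | rfl)
      · simpa using h1
      · exact h2
      · simpa using h3
    · obtain ⟨t', rfl⟩ := h.t_eq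
      obtain ⟨p', rfl⟩ := h.p_eq
      simp [Absorbs, List.cons_lt_cons_iff, append_lt_append_iff_left,
        lt_append_right]
  refine ⟨?_, ?_, ?_, ?_, ?_, ?_, ?_, ?_, hD', ?_, ?_⟩
  · obtain ⟨t', rfl⟩ := h.t_eq
    exact ⟨_, rfl⟩
  · obtain ⟨p', rfl⟩ := h.p_eq
    exact ⟨_, rfl⟩
  · simp [h.flatten_eq]
  · refine isChain_append_of_le h.isChain (fun g hg => ?_) (List.isChain_singleton _)
    rw [List.append_assoc]
    exact h.le_of_mem g hg _
  · intro g hg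
    rcases List.mem_append.1 hg with hg | hg
    · exact h.nf_mem g hg
    · rw [List.mem_singleton.1 hg]
      exact h.nf_btp _ (by simp)
  · refine h.absorbs.append ⟨?_, trivial⟩
    rw [h.flatten_eq]
    obtain ⟨t', rfl⟩ := h.t_eq
    obtain ⟨p', rfl⟩ := h.p_eq
    simp [List.cons_lt_cons_iff, append_lt_append_iff_left]
  · intro g hg w
    rcases List.mem_append.1 hg with hg | hg
    · have := h.le_of_mem g hg (p ++ b :: p ++ b :: t ++ w)
      simpa using this
    · rw [List.mem_singleton.1 hg]
      exact hle w
  · refine h.nf_cons (v := []) (M := []) (by simp [h.flatten_eq]) (List.isChain_singleton _) ?_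
      ⟨?_, trivial⟩
    · simpa using h.nf_bt
    · rw [List.append_nil, List.append_assoc]
      obtain ⟨p', rfl⟩ := h.p_eq
      exact lt_append_right _ (by simp)
  · intro v hv
    -- Cut b T P b T T P v as b · (t p b p) · (b t P) · (b T T P v); the last block comes from `hD'`
    -- at the new level.
    refine h.nf_cons (v := p ++ b :: t ++ t ++ p) (M := [b :: (t ++ p ++ b :: p ++ b :: t) ++
      (t ++ p ++ b :: p ++ b :: t) ++ (p ++ b :: t ++ t ++ p) ++ v]) ?_ ?_ ?_ ?_
    · simp [h.flatten_eq]
    · obtain ⟨t', rfl⟩ := h.t_eq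
      obtain ⟨p', rfl⟩ := h.p_eq
      refine List.isChain_pair.2 (le_of_lt ?_)
      simp [List.cons_lt_cons_iff, append_lt_append_iff_left]
    · have h1 := h.nf_btp [] (by simp)
      have h2 := hD' v hv
      simp only [List.mem_cons, List.not_mem_nil, or_false]
      rintro g (rfl | rfl)
      · simpa using h1
      · exact h2
    · obtain ⟨t', rfl⟩ := h.t_eq
      obtain ⟨p', rfl⟩ := h.p_eq
      simp [Absorbs, List.cons_lt_cons_iff, append_lt_append_iff_left]
  · refine h.nf_cons (v := t ++ p ++ b :: p)
      (M := [b :: t ++ (p ++ b :: t ++ t ++ p) ++ b :: (p ++ b :: t ++ t ++ p)]) ?_ ?_ ?_ ?_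
    · simp [h.flatten_eq]
    · obtain ⟨t', rfl⟩ := h.t_eq
      obtain ⟨p', rfl⟩ := h.p_eq
      refine List.isChain_pair.2 (le_of_lt ?_)
      simp [List.cons_lt_cons_iff, append_lt_append_iff_left]
    · have h1 := h.nf_bttpbp
      have h2 := h.nf_btp _ (List.mem_cons_of_mem _ (List.mem_cons_of_mem _ List.mem_cons_self))
      simp only [List.mem_cons, List.not_mem_nil, or_false]
      rintro g (rfl | rfl)
      · simpa using h1
      · exact h2
    · obtain ⟨t', rfl⟩ := h.t_eq
      obtain ⟨p', rfl⟩ := h.p_eq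
      simp [Absorbs, List.cons_lt_cons_iff, append_lt_append_iff_left]

/-! ### Factorizations of the Thue–Morse words -/

theorem flip_append (u v : List Bool) : flip (u ++ v) = flip u ++ flip v :=
  List.map_append

theorem flip_flip (u : List Bool) : flip (flip u) = u := by
  simp [flip, Function.comp_def]

/-- The stable Nyldon factors of the Thue-Morse words: those of `TM (2 * k + 4)` but the last. -/
def stableFactors : ℕ → List (List Bool)
  | 0 => [[a], [b], [b, a], [b, a, a, b, b, a, a]]
  | k + 1 => stableFactors k ++ [b :: TM (2 * k + 2) ++ flip (TM (2 * k + 4)) ++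
      (flip (TM (2 * k + 4))).dropLast]

theorem TM_even (k : ℕ) : TM (2 * k + 4) =
    TM (2 * k + 2) ++ flip (TM (2 * k + 2)) ++ flip (TM (2 * k + 2)) ++ TM (2 * k + 2) := by
  simp [TM, flip_append, flip_flip]

theorem flip_TM_even (k : ℕ) : flip (TM (2 * k + 4)) =
    flip (TM (2 * k + 2)) ++ TM (2 * k + 2) ++ TM (2 * k + 2) ++ flip (TM (2 * k + 2)) := by
  simp [TM_even, flip_append, flip_flip]

theorem tower_TM (k : ℕ) : ∃ p, flip (TM (2 * k + 2)) = p ++ [b] ∧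
    Tower (TM (2 * k + 2)) p (stableFactors k) := by
  induction k with
  | zero => exact ⟨[b, a, a], rfl, tower_one⟩
  | succ k ih =>
    obtain ⟨p, hp, h⟩ := ih
    have hT : TM (2 * (k + 1) + 2) =
        TM (2 * k + 2) ++ p ++ b :: p ++ b :: TM (2 * k + 2) := by
      rw [mul_add, TM_even, hp]
      simp
    have hF : flip (TM (2 * k + 4)) = (p ++ b :: TM (2 * k + 2) ++ TM (2 * k + 2) ++ p) ++ [b] := by
      rw [flip_TM_even, hp]
      simp
    refine ⟨p ++ b :: TM (2 * k + 2) ++ TM (2 * k + 2) ++ p, hF, ?_⟩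
    have := h.succ
    rw [hT, stableFactors, hF, List.dropLast_concat]
    convert this using 2
    simp

theorem Tower.nf_flatten_append {t p : List Bool} {L : List (List Bool)} (h : Tower t p L)
    {v : List Bool} (hv : nf (b :: t ++ v) = [b :: t ++ v]) :
    nf (t ++ p ++ b :: p ++ b :: t ++ v) = L ++ [b :: t ++ v] := by
  have := nf_flatten (isChain_append_of_le h.isChain (fun g hg => h.le_of_mem g hg v)
    (List.isChain_singleton _)) fun g hg => (List.mem_append.1 hg).elim (h.nf_mem g)
      fun hg => by rwa [List.mem_singleton.1 hg]
  simpa [h.flatten_eq] using this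

theorem NF_TM_even (k : ℕ) :
    NF (TM (2 * k + 4)) (stableFactors k ++ [[b] ++ TM (2 * k + 2)]) := by
  obtain ⟨p, hp, h⟩ := tower_TM k
  have := h.nf_flatten_append (v := []) (by simpa using h.nf_bt)
  rw [NF_iff_nf, TM_even, hp]
  simpa using this

theorem NF_TM_odd (k : ℕ) : NF (TM (2 * k + 5))
    (stableFactors k ++ [[b] ++ TM (2 * k + 2) ++ flip (TM (2 * k + 4))]) := by
  obtain ⟨p, hp, h⟩ := tower_TM k
  have := h.nf_flatten_append (v := (p ++ b :: TM (2 * k + 2) ++ TM (2 * k + 2) ++ p) ++ [b])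
    (by simpa using h.nf_btp [b] (by simp))
  rw [NF_iff_nf, TM, flip_TM_even, TM_even, hp]
  simpa using this

theorem NF_TM_three : NF (TM 3) [[a], [b], [b, a], [b, a, a, b]] := by
  rw [NF_iff_nf]
  decide

theorem dropLast_flip (u : List Bool) : (flip u).dropLast = flip u.dropLast :=
  List.map_dropLast.symm

end ThueMorse

end NyldonTM

theorem mainTheorem2 (k : ℕ) (hk : 2 ≤ k) :
    ∃ (x : List (List Bool)) (y : List Bool),
      -- `x` lists all factors but the last, and `y` is the last factor
      NyldonTM.NF (NyldonTM.TM (2 * k - 1)) (x ++ [y]) ∧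
      -- for `k ≥ 3`, the number of factors in `x` is the number of factors one level below
      (3 ≤ k → ∃ z : List (List Bool),
        NyldonTM.NF (NyldonTM.TM (2 * (k - 1) - 1)) z ∧ x.length = z.length) ∧
      NyldonTM.NF (NyldonTM.TM (2 * k))
        (x ++ [y ++ NyldonTM.flip (NyldonTM.TM (2 * k - 2)).dropLast,
          [NyldonTM.b] ++ NyldonTM.TM (2 * k - 2)]) ∧
      NyldonTM.NF (NyldonTM.TM (2 * k + 1))
        (x ++ [y ++ NyldonTM.flip (NyldonTM.TM (2 * k - 2)).dropLast,
          [NyldonTM.b] ++ NyldonTM.TM (2 * k - 2) ++ NyldonTM.flip (NyldonTM.TM (2 * k))]) := by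
  open NyldonTM in
  obtain ⟨j, rfl⟩ := Nat.exists_eq_add_of_le' hk
  cases j with
  | zero =>
    -- TM_3 lies below the tower, but baab·baa is the last entry of `stableFactors 0`.
    exact ⟨[[a], [b], [b, a]], [b, a, a, b], NF_TM_three, fun h => absurd h (by decide),
      NF_TM_even 0, NF_TM_odd 0⟩
  | succ j =>
    have hs : ∀ w, stableFactors j ++ [[b] ++ TM (2 * j + 2) ++ flip (TM (2 * j + 4)) ++
        flip (TM (2 * j + 4)).dropLast, w] = stableFactors (j + 1) ++ [w] := by
      simp [stableFactors, dropLast_flip]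
    refine ⟨stableFactors j, [b] ++ TM (2 * j + 2) ++ flip (TM (2 * j + 4)), NF_TM_odd j,
      fun _ => ?_, ?_, ?_⟩
    · cases j with
      | zero => exact ⟨_, NF_TM_three, rfl⟩
      | succ j => exact ⟨_, NF_TM_odd j, by simp [stableFactors]⟩
    · have := NF_TM_even (j + 1)
      rw [← hs] at this
      exact this
    · have := NF_TM_odd (j + 1)
      rw [← hs] at this
      exact this
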